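/- Let $K$ be a field. A sequence $(u_n)_{n\ge 0}$ in a commutative ring $R$ is called eventually linearly recursive if there are $d,N\in\mathbb{N}$ and $c_0,\dots,c_{d-1}\in R$ with $u_{n+d}=\sum_{i=0}^{d-1}c_i\,u_{n+i}$ for all $n\ge N$. For a Laurent polynomial $Q=\sum_{k\in\mathbb{Z}}c_kx^k\in K[x,x^{-1}]$ and sequences $\mathbf a=(a_k)_{k\ge 0}$, $\mathbf b=(b_k)_{k\ge 0}$ in $K$ put $$Q\triangleright(\mathbf a,\mathbf b)=\sum_{k\ge 0}c_k a_k+\sum_{k<0}c_k b_{-k-1}\in K .$$ **Theorem.** Let $(P_n)_{n\ge 0}$ be an eventually linearly recursive sequence in the ring $K[x,x^{-1}]$, and let $\mathbf a$, $\mathbf b$ be eventually linearly recursive sequences in $K$. Then the sequence $\bigl(P_n\triangleright(\mathbf a,\mathbf b)\bigr)_{n\ge 0}$ is algebraic: its Hilbert series $$H(t)=\sum_{n\ge 0}\bigl(P_n\triangleright(\mathbf a,\mathbf b)\bigr)t^n\in K[[t]]$$ satisfies an equation $A_m(t)H(t)^m+\cdots+A_1(t)H(t)+A_0(t)=0$ in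 $K[[t]]$ with $m\ge 0$ and polynomials $A_0,\dots,A_m\in K[t]$ that are not all zero. -/

import Mathlib

/-- A sequence `u` in a commutative ring is *eventually linearly recursive* if, after dropping
finitely many initial terms, it satisfies a linear recurrence with constant coefficients in that
ring: `u (n + d) = c₀ * u n + ⋯ + c_{d-1} * u (n + d - 1)` for all `n ≥ N`. -/
def IsEventuallyLinearRecursive {R : Type*} [CommRing R] (u : ℕ → R) : Prop :=
  ∃ (E : LinearRecurrence R) (N : ℕ), E.IsSolution (fun n => u (n + N))

/-- The Hilbert series `∑ uₙ tⁿ` of a sequence. -/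
def hilbertSeries {K : Type*} [Field K] (u : ℕ → K) : PowerSeries K :=
  PowerSeries.mk u

/-- For a Laurent polynomial `P = ∑ cₖ xᵏ` and sequences `a`, `b`, the scalar
`P ▷ (a, b) = ∑_{k ≥ 0} cₖ a_k + ∑_{k < 0} cₖ b_{-k-1}`. -/
noncomputable def laurentSubst {K : Type*} [Field K] (P : LaurentPolynomial K) (a b : ℕ → K) : K :=
  P.coeff.sum fun k c => if 0 ≤ k then c * a k.toNat else c * b (-k - 1).toNat

/-- A sequence over a field is *algebraic* if its Hilbert series `H` satisfies an equation
`P_d(t) H^d + ⋯ + P_1(t) H + P_0(t) = 0` in `K⟦t⟧` with polynomials `P_i`, not all zero. -/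
def IsAlgebraicSequence {K : Type*} [Field K] (u : ℕ → K) : Prop :=
  IsAlgebraic (Polynomial K) (hilbertSeries u)

/-! Put `G = ∑ Pₙ tⁿ` and let `l` be the functional with `x^k ↦ a_k` and `x^(-k-1) ↦ b_k` for `k ≥
0`; then `H` is `l` applied to `G` coefficientwise in `t`. The recurrence makes `G` a quotient `N /
D` of Laurent polynomials in `x` over `K[t]`, with `D ≡ 1` modulo `t`.

For suitable `M`, `f = x^M D` is a polynomial in `x` with `f ≡ x^M`. Weierstrass preparation splits
it as `f = g h` with `g` monic, `g ≡ x^M` and `h ≡ 1`; the factors have algebraic coefficients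
because `g` divides `f` (`exists_factorization`). They are coprime, so `1/f` splits into partial
fractions over `g` and `h`.

The series `1/h` has coefficients in `K[x]`, and recursivity of `a` makes `l` vanish on `q K[x] x^j`
for some monic `q`. As `q` is coprime to `h`, up to terms killed by `l` the series `x^j / h` is a
Laurent polynomial with algebraic coefficients (`coeffwise_monom_mul_mem`). The substitution `x ↦
1/x` brings `1/g` to the same form, with `b` in place of `a`. -/

/-! ### Polynomials over local rings: coprimality and factorization. -/

/-- A monic polynomial over a local ring is coprime to every polynomial congruent to `1` modulo
the maximal ideal. -/
theorem Polynomial.Monic.isCoprime_of_map_residue_eq_one {A : Type*} [CommRing A] [IsLocalRing A]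
    {g h : Polynomial A} (hg : g.Monic) (hh : h.map (IsLocalRing.residue A) = 1) :
    IsCoprime g h := by
  rw [← Ideal.isCoprime_span_singleton_iff, Ideal.isCoprime_iff_sup_eq]
  by_contra hne
  obtain ⟨M, hM, hle⟩ := Ideal.exists_le_maximal _ hne
  have hgM : g ∈ M := hle (Ideal.mem_sup_left (Ideal.mem_span_singleton_self g))
  have hhM : h ∈ M := hle (Ideal.mem_sup_right (Ideal.mem_span_singleton_self h))
  -- As `M` contains the monic `g`, the quotient by `M` is integral over `A`. So `M` lies over the
  -- maximal ideal of `A` and contains `h - 1`.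
  have hint : ((Ideal.Quotient.mk M).comp Polynomial.C).IsIntegral := hg.quotient_isIntegral hgM
  have hmax : (M.comap (Polynomial.C : A →+* Polynomial A)).IsMaximal := by
    let : Field (Polynomial A ⧸ M) := Ideal.Quotient.field M
    have h1 := Ideal.isMaximal_comap_of_isIntegral_of_isMaximal' _ hint
      (⊥ : Ideal (Polynomial A ⧸ M))
    rwa [← Ideal.comap_comap, ← RingHom.ker_eq_comap_bot, Ideal.mk_ker] at h1
  have hmem : h - 1 ∈ M := by
    have hk : h - 1 ∈ RingHom.ker (Polynomial.mapRingHom (IsLocalRing.residue A)) := by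
      simp [RingHom.mem_ker, hh]
    rw [Polynomial.ker_mapRingHom, IsLocalRing.ker_residue,
      ← IsLocalRing.eq_maximalIdeal hmax] at hk
    exact Ideal.map_comap_le hk
  exact hM.ne_top ((Ideal.eq_top_iff_one M).2 (by simpa using M.sub_mem hhM hmem))

/-- If a monic polynomial divides a nonzero polynomial with algebraic coefficients, then its
coefficients are algebraic. -/
theorem Polynomial.isAlgebraic_coeff_of_dvd {A R : Type*} [CommRing A] [IsDomain A] [CommRing R]
    [IsDomain R] [Algebra A R] [FaithfulSMul A R] {f : Polynomial A} {g : Polynomial R}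
    (hf : f ≠ 0) (hg : g.Monic) (hdvd : g ∣ f.map (algebraMap A R)) (i : ℕ) :
    IsAlgebraic A (g.coeff i) := by
  let F := FractionRing R
  let k := FractionRing A
  let : Algebra k F := FractionRing.liftAlgebra A F
  let p : Polynomial k := f.map (algebraMap A k)
  have hp : p ≠ 0 := (Polynomial.map_ne_zero_iff (IsFractionRing.injective A k)).2 hf
  -- Over the field `k`, scaling makes `f` monic, so the coefficients of a monic divisor are
  -- integral over `k`.
  have hm : (p * Polynomial.C p.leadingCoeff⁻¹).Monic := Polynomial.monic_mul_leadingCoeff_inv hp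
  have hpm : p.map (algebraMap k F) = (f.map (algebraMap A R)).map (algebraMap R F) := by
    rw [Polynomial.map_map, Polynomial.map_map, ← IsScalarTower.algebraMap_eq,
      ← IsScalarTower.algebraMap_eq]
  have hd : g.map (algebraMap R F) ∣ (p * Polynomial.C p.leadingCoeff⁻¹).map (algebraMap k F) := by
    rw [Polynomial.map_mul, hpm]
    exact (Polynomial.map_dvd _ hdvd).mul_right _
  have hi := Polynomial.isIntegral_coeff_of_dvd _ _ hm (hg.map _) hd i
  rw [Polynomial.coeff_map, ← isAlgebraic_iff_isIntegral,
    ← IsFractionRing.isAlgebraic_iff A k F] at hi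
  exact (isAlgebraic_algebraMap_iff (IsFractionRing.injective R F)).1 hi

/-- Over a complete local ring, a polynomial congruent to a power of `X` modulo the maximal ideal
is divisible by a distinguished polynomial of that degree. -/
theorem Polynomial.exists_monic_dvd_of_map_residue_eq_X_pow {R : Type*} [CommRing R]
    [IsLocalRing R] [IsAdicComplete (IsLocalRing.maximalIdeal R) R] {f : Polynomial R} {M : ℕ}
    (hf : f.map (IsLocalRing.residue R) = Polynomial.X ^ M) :
    ∃ g : Polynomial R, g.Monic ∧ g.map (IsLocalRing.residue R) = Polynomial.X ^ M ∧ g ∣ f := by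
  have hmap : (f : PowerSeries R).map (IsLocalRing.residue R) = PowerSeries.X ^ M := by
    rw [← Polynomial.polynomial_map_coe, hf]; simp
  have hne : (f : PowerSeries R).map (IsLocalRing.residue R) ≠ 0 := by
    rw [hmap]; exact pow_ne_zero _ PowerSeries.X_ne_zero
  obtain ⟨g, h, H⟩ := PowerSeries.exists_isWeierstrassFactorization hne
  have hdeg : g.natDegree = M := by
    rw [H.natDegree_eq_toNat_order_map, hmap, PowerSeries.order_X_pow]; rfl
  have hgm := H.isDistinguishedAt.monic
  have hgX : g.map (IsLocalRing.residue R) = Polynomial.X ^ M := by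
    rw [← hdeg]; exact H.isDistinguishedAt.map_eq_X_pow
  refine ⟨g, hgm, hgX, ?_⟩
  have hord : ((g : PowerSeries R).map (IsLocalRing.residue R)).order.toNat = M := by
    rw [← Polynomial.polynomial_map_coe, hgX]; simp [PowerSeries.order_X_pow]
  have hgne : (g : PowerSeries R).map (IsLocalRing.residue R) ≠ 0 := by
    rw [← Polynomial.polynomial_map_coe, hgX]; simp
  -- Divisibility by `g` descends from power series to polynomials: Euclidean division is also a
  -- Weierstrass division, and uniqueness forces its remainder to be zero.
  have d1 : (f : PowerSeries R).IsWeierstrassDivision g h 0 :=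
    ⟨by simp, by simpa using H.eq_mul⟩
  have d2 : (f : PowerSeries R).IsWeierstrassDivision g (f /ₘ g : Polynomial R) (f %ₘ g) := by
    refine ⟨?_, ?_⟩
    · refine (Polynomial.degree_modByMonic_lt f hgm).trans_le ?_
      change _ ≤ ((((g : PowerSeries R).map (IsLocalRing.residue R)).order.toNat : ℕ) : WithBot ℕ)
      rw [hord, ← hdeg]; exact Polynomial.degree_le_natDegree
    · rw [← Polynomial.coe_mul, ← Polynomial.coe_add, add_comm, Polynomial.modByMonic_add_div]
  have h0 := (d2.elim hgne d1).2
  exact (Polynomial.modByMonic_eq_zero_iff_dvd hgm).1 h0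

/-! ### The local ring of algebraic series. -/

/-- The ring of algebraic formal power series over `K`. -/
noncomputable abbrev algebraicSeries (K : Type*) [Field K] :
    Subalgebra (Polynomial K) (PowerSeries K) :=
  Subalgebra.algebraicClosure (Polynomial K) (PowerSeries K)

namespace algebraicSeries

variable {K : Type*} [Field K]

instance : IsAdicComplete (IsLocalRing.maximalIdeal (PowerSeries K)) (PowerSeries K) := by
  rw [PowerSeries.maximalIdeal_eq_span_X]; infer_instance

/-- Inverses of algebraic elements are algebraic; hence locality descends from `K⟦t⟧`. -/
instance isLocalHom_val : IsLocalHom (algebraicSeries K).val.toRingHom where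
  map_nonunit a ha := by
    have ha' : IsUnit (a : PowerSeries K) := ha
    let := ha'.invertible
    have hinv : IsAlgebraic (Polynomial K) (⅟(a : PowerSeries K)) := IsAlgebraic.invOf a.2
    exact IsUnit.of_mul_eq_one (⟨⅟(a : PowerSeries K), hinv⟩ : algebraicSeries K)
      (Subtype.ext (mul_invOf_self _))

instance : IsLocalRing (algebraicSeries K) :=
  (algebraicSeries K).val.toRingHom.domain_isLocalRing

/-- The constant coefficient of an algebraic series. -/
noncomputable def constantCoeff : algebraicSeries K →+* K :=
  PowerSeries.constantCoeff.comp (algebraicSeries K).val.toRingHom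

instance : IsLocalHom (constantCoeff (K := K)) where
  map_nonunit a ha := by
    have : IsUnit (a : PowerSeries K) := PowerSeries.isUnit_iff_constantCoeff.2 ha
    exact (isLocalHom_val (K := K)).map_nonunit a this

theorem mem_of_isAlgebraic {x : PowerSeries K} (hx : IsAlgebraic (algebraicSeries K) x) :
    x ∈ algebraicSeries K :=
  hx.restrictScalars (Polynomial K)

/-- The scalars, as algebraic series. -/
noncomputable def C : K →+* algebraicSeries K :=
  (algebraMap (Polynomial K) (algebraicSeries K)).comp Polynomial.C

@[simp] theorem coe_C (c : K) : ((C c : algebraicSeries K) : PowerSeries K) = PowerSeries.C c := by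
  change algebraMap (Polynomial K) (PowerSeries K) (Polynomial.C c) = _
  simp [PowerSeries.algebraMap_apply']

/-- The series `t`, as an algebraic series. -/
noncomputable def X : algebraicSeries K :=
  algebraMap (Polynomial K) (algebraicSeries K) Polynomial.X

@[simp] theorem coe_X : ((X : algebraicSeries K) : PowerSeries K) = PowerSeries.X := by
  change algebraMap (Polynomial K) (PowerSeries K) Polynomial.X = _
  simp [PowerSeries.algebraMap_apply']

instance : IsLocalHom (PowerSeries.constantCoeff (R := K)) where
  map_nonunit _ ha := PowerSeries.isUnit_iff_constantCoeff.2 ha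

/-- The residue field embeds in `K` through `φ`, so reductions can be read off from constant
coefficients. -/
theorem map_residue_eq_X_pow_iff {S : Type*} [CommRing S] [IsLocalRing S] (φ : S →+* K)
    [IsLocalHom φ] {p : Polynomial S} {n : ℕ} :
    p.map (IsLocalRing.residue S) = Polynomial.X ^ n ↔ p.map φ = Polynomial.X ^ n := by
  have h : p.map φ = (p.map (IsLocalRing.residue S)).map (IsLocalRing.ResidueField.lift φ) := by
    rw [Polynomial.map_map, IsLocalRing.ResidueField.lift_comp_residue]
  rw [h]
  refine ⟨fun hp => by simp [hp], fun hp => ?_⟩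
  have hinj := Polynomial.map_injective (IsLocalRing.ResidueField.lift φ)
    (IsLocalRing.ResidueField.lift φ).injective
  exact hinj (by rw [hp, Polynomial.map_pow, Polynomial.map_X])

theorem isCoprime {g h : Polynomial (algebraicSeries K)} (hg : g.Monic)
    (hh : h.map constantCoeff = 1) : IsCoprime g h :=
  hg.isCoprime_of_map_residue_eq_one <|
    (map_residue_eq_X_pow_iff constantCoeff (n := 0)).2 hh

/-- A polynomial over the algebraic series whose reduction is `x ^ M` is the product of a monic
polynomial with reduction `x ^ M` and a polynomial with reduction `1`. -/
theorem exists_factorization {f : Polynomial (algebraicSeries K)} {M : ℕ}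
    (hf : f.map constantCoeff = Polynomial.X ^ M) :
    ∃ g h : Polynomial (algebraicSeries K), f = g * h ∧ g.Monic ∧
      g.map constantCoeff = Polynomial.X ^ M ∧ h.map constantCoeff = 1 := by
  have hcomp : (constantCoeff : algebraicSeries K →+* K) =
    PowerSeries.constantCoeff.comp (algebraMap (algebraicSeries K) (PowerSeries K)) := rfl
  have hinj : Function.Injective (algebraMap (algebraicSeries K) (PowerSeries K)) :=
    Subtype.val_injective
  have hf0 : f ≠ 0 := by
    rintro rfl
    exact pow_ne_zero M (Polynomial.X_ne_zero (R := K)) (by simpa using hf.symm)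
  rw [hcomp, ← Polynomial.map_map, ← map_residue_eq_X_pow_iff] at hf
  obtain ⟨g, hgm, hgX, hdvd⟩ := Polynomial.exists_monic_dvd_of_map_residue_eq_X_pow hf
  -- The factor `g` is found over `K⟦t⟧`; its coefficients are algebraic over the algebraic series,
  -- hence algebraic.
  have hlift : g ∈ Polynomial.lifts (algebraMap (algebraicSeries K) (PowerSeries K)) := by
    rw [Polynomial.lifts_iff_coeff_lifts]
    exact fun n => ⟨⟨_, mem_of_isAlgebraic (Polynomial.isAlgebraic_coeff_of_dvd hf0 hgm hdvd n)⟩,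
      rfl⟩
  obtain ⟨g, rfl, -, hgm'⟩ := Polynomial.lifts_and_degree_eq_and_monic hlift hgm
  obtain ⟨h, rfl⟩ := (Polynomial.map_dvd_map _ hinj hgm').1 hdvd
  have hg' : g.map constantCoeff = Polynomial.X ^ M := by
    rwa [map_residue_eq_X_pow_iff PowerSeries.constantCoeff, Polynomial.map_map] at hgX
  refine ⟨g, h, rfl, hgm', hg', ?_⟩
  rw [map_residue_eq_X_pow_iff PowerSeries.constantCoeff, Polynomial.map_map,
    ← hcomp, Polynomial.map_mul, hg'] at hf
  exact mul_left_cancel₀ (pow_ne_zero M (Polynomial.X_ne_zero (R := K))) (by simpa using hf)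

end algebraicSeries

/-! ### Series in `t` with Laurent polynomial coefficients. -/

/-- Coefficientwise extension of a linear functional on Laurent polynomials to power series with
Laurent polynomial coefficients. -/
noncomputable def LaurentPolynomial.coeffwise {K : Type*} [Field K]
    (l : LaurentPolynomial K →ₗ[K] K) :
    PowerSeries (LaurentPolynomial K) →ₗ[PowerSeries K] PowerSeries K where
  toFun F := PowerSeries.mk fun n => l (PowerSeries.coeff n F)
  map_add' F G := by ext n; simp
  map_smul' r F := by
    ext n
    rw [Algebra.smul_def, PowerSeries.algebraMap_apply'']
    simp only [PowerSeries.coeff_mk, PowerSeries.coeff_mul, PowerSeries.coeff_map, map_sum,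
      RingHom.id_apply, smul_eq_mul, ← Algebra.smul_def, map_smul]

theorem PowerSeries.constantCoeff_map {R S : Type*} [Semiring R] [Semiring S] (f : R →+* S)
    (F : PowerSeries R) :
    PowerSeries.constantCoeff (PowerSeries.map f F) = f (PowerSeries.constantCoeff F) := by
  rw [← PowerSeries.coeff_zero_eq_constantCoeff_apply, PowerSeries.coeff_map,
    PowerSeries.coeff_zero_eq_constantCoeff_apply]

namespace algebraicSeries

open LaurentPolynomial (coeffwise)

variable {K : Type*} [Field K]

@[simp] theorem coeff_coeffwise (l : LaurentPolynomial K →ₗ[K] K)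
    (F : PowerSeries (LaurentPolynomial K)) (n : ℕ) :
    PowerSeries.coeff n (coeffwise l F) = l (PowerSeries.coeff n F) :=
  PowerSeries.coeff_mk n fun n => l (PowerSeries.coeff n F)

theorem algebraMap_eq_map (a : algebraicSeries K) :
    algebraMap (algebraicSeries K) (PowerSeries (LaurentPolynomial K)) a =
      PowerSeries.map LaurentPolynomial.C (a : PowerSeries K) :=
  rfl

/-- The monomial `x ^ j`, as a power series with constant term `x ^ j`. -/
noncomputable def monom (K : Type*) [Field K] (j : ℤ) : PowerSeries (LaurentPolynomial K) :=
  PowerSeries.C (LaurentPolynomial.T j)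

theorem monom_add (i j : ℤ) : monom K (i + j) = monom K i * monom K j := by
  rw [monom, LaurentPolynomial.T_add, map_mul, monom, monom]

@[simp] theorem monom_zero : monom K 0 = 1 := by simp [monom]

/-- A polynomial in `x` whose coefficients are algebraic series in `t`, as a series in `t`
whose coefficients are polynomials in `x`. -/
noncomputable def toSeries : Polynomial (algebraicSeries K) →+* PowerSeries (Polynomial K) :=
  Polynomial.eval₂RingHom ((PowerSeries.map Polynomial.C).comp (algebraicSeries K).val.toRingHom)
    (PowerSeries.C Polynomial.X)

/-- A polynomial in `x` whose coefficients are algebraic series in `t`, as a series in `t`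
whose coefficients are Laurent polynomials in `x`. -/
noncomputable def toLaurentSeries :
    Polynomial (algebraicSeries K) →+* PowerSeries (LaurentPolynomial K) :=
  (PowerSeries.map Polynomial.toLaurent).comp toSeries

theorem toSeries_map_C (p : Polynomial K) : toSeries (p.map C) = PowerSeries.C p := by
  induction p using Polynomial.induction_on' with
  | add p q hp hq => simp [hp, hq]
  | monomial n c =>
    simp [toSeries, ← Polynomial.C_mul_X_pow_eq_monomial]

theorem constantCoeff_toSeries (p : Polynomial (algebraicSeries K)) :
    PowerSeries.constantCoeff (toSeries p) = p.map constantCoeff := by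
  induction p using Polynomial.induction_on' with
  | add p q hp hq => simp [hp, hq]
  | monomial n c =>
    simp only [toSeries, ← Polynomial.C_mul_X_pow_eq_monomial, constantCoeff, map_mul, map_pow,
      Polynomial.coe_eval₂RingHom, Polynomial.eval₂_C, Polynomial.eval₂_X, Polynomial.map_mul,
      Polynomial.map_pow, Polynomial.map_C, Polynomial.map_X, PowerSeries.constantCoeff_C,
      RingHom.comp_apply, PowerSeries.constantCoeff_map]

theorem constantCoeff_toLaurentSeries (p : Polynomial (algebraicSeries K)) :
    PowerSeries.constantCoeff (toLaurentSeries p) = (p.map constantCoeff).toLaurent := by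
  rw [toLaurentSeries, RingHom.comp_apply, PowerSeries.constantCoeff_map, constantCoeff_toSeries]

theorem toLaurentSeries_eq_eval₂ (p : Polynomial (algebraicSeries K)) :
    toLaurentSeries p = p.eval₂ (algebraMap (algebraicSeries K) _) (monom K 1) := by
  rw [toLaurentSeries, RingHom.comp_apply, toSeries, Polynomial.coe_eval₂RingHom,
    Polynomial.hom_eval₂]
  congr 1
  · ext a n
    simp [algebraMap_eq_map]
  · simp [monom]

@[simp] theorem toLaurentSeries_X : toLaurentSeries (K := K) Polynomial.X = monom K 1 := by
  simp [toLaurentSeries_eq_eval₂]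

theorem toLaurentSeries_X_pow (n : ℕ) :
    toLaurentSeries (K := K) (Polynomial.X ^ n) = monom K n := by
  rw [map_pow, toLaurentSeries_X, monom, ← map_pow, LaurentPolynomial.T_pow, mul_one, monom]

@[simp] theorem toLaurentSeries_C (a : algebraicSeries K) :
    toLaurentSeries (Polynomial.C a) = algebraMap (algebraicSeries K) _ a := by
  simp [toLaurentSeries_eq_eval₂]

/-- The Laurent polynomials in `x` with algebraic series in `t` as coefficients. -/
noncomputable def laurentSpan (K : Type*) [Field K] :
    Submodule (algebraicSeries K) (PowerSeries (LaurentPolynomial K)) :=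
  Submodule.span _ (Set.range (monom K))

theorem monom_mem (j : ℤ) : monom K j ∈ laurentSpan K := Submodule.subset_span ⟨j, rfl⟩

theorem toLaurentSeries_mul_monom_mem (p : Polynomial (algebraicSeries K)) (j : ℤ) :
    toLaurentSeries p * monom K j ∈ laurentSpan K := by
  induction p using Polynomial.induction_on' with
  | add p q hp hq => rw [map_add, add_mul]; exact add_mem hp hq
  | monomial n a =>
    rw [← Polynomial.C_mul_X_pow_eq_monomial, map_mul, toLaurentSeries_X_pow, toLaurentSeries_C,
      mul_assoc, ← monom_add, ← Algebra.smul_def]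
    exact Submodule.smul_mem _ _ (monom_mem _)

theorem C_mem (Q : LaurentPolynomial K) : PowerSeries.C Q ∈ laurentSpan K := by
  induction Q using LaurentPolynomial.induction_on' with
  | add p q hp hq => rw [map_add]; exact add_mem hp hq
  | C_mul_T j c =>
    have : PowerSeries.C (LaurentPolynomial.C c * LaurentPolynomial.T j) =
        (C c : algebraicSeries K) • monom K j := by
      rw [Algebra.smul_def, map_mul, monom, algebraMap_eq_map, coe_C, PowerSeries.map_C]
    rw [this]
    exact Submodule.smul_mem _ _ (monom_mem j)

theorem X_pow_mul_mem {W : PowerSeries (LaurentPolynomial K)} (hW : W ∈ laurentSpan K) (n : ℕ) :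
    PowerSeries.X ^ n * W ∈ laurentSpan K := by
  have : PowerSeries.X ^ n * W = (X ^ n : algebraicSeries K) • W := by
    rw [Algebra.smul_def, map_pow, algebraMap_eq_map, coe_X, PowerSeries.map_X]
  rw [this]
  exact Submodule.smul_mem _ _ hW

/-- Clearing the denominator `x ^ M`. -/
theorem exists_toLaurentSeries_eq {W : PowerSeries (LaurentPolynomial K)}
    (hW : W ∈ laurentSpan K) :
    ∃ (M : ℕ) (p : Polynomial (algebraicSeries K)), toLaurentSeries p = monom K M * W := by
  induction hW using Submodule.span_induction with
  | mem _ h =>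
    obtain ⟨j, rfl⟩ := h
    refine ⟨j.natAbs, Polynomial.X ^ (j.natAbs + j).toNat, ?_⟩
    rw [toLaurentSeries_X_pow, ← monom_add]
    congr 1; omega
  | zero => exact ⟨0, 0, by simp⟩
  | add V W _ _ hV hW =>
    obtain ⟨m, p, hp⟩ := hV
    obtain ⟨n, q, hq⟩ := hW
    refine ⟨m + n, Polynomial.X ^ n * p + Polynomial.X ^ m * q, ?_⟩
    rw [map_add, map_mul, map_mul, hp, hq, toLaurentSeries_X_pow, toLaurentSeries_X_pow,
      Nat.cast_add, monom_add]
    ring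
  | smul a W _ hW =>
    obtain ⟨m, p, hp⟩ := hW
    refine ⟨m, Polynomial.C a * p, ?_⟩
    rw [map_mul, hp, toLaurentSeries_C, Algebra.smul_def]
    ring

theorem coeffwise_smul (l : LaurentPolynomial K →ₗ[K] K) (a : algebraicSeries K)
    (F : PowerSeries (LaurentPolynomial K)) :
    coeffwise l (a • F) = (a : PowerSeries K) * coeffwise l F :=
  (coeffwise l).map_smul (a : PowerSeries K) F

theorem coeffwise_mul_mem {l : LaurentPolynomial K →ₗ[K] K}
    {u : PowerSeries (LaurentPolynomial K)}
    (hu : ∀ j, coeffwise l (monom K j * u) ∈ algebraicSeries K)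
    {W : PowerSeries (LaurentPolynomial K)} (hW : W ∈ laurentSpan K) :
    coeffwise l (W * u) ∈ algebraicSeries K := by
  induction hW using Submodule.span_induction with
  | mem _ h => obtain ⟨j, rfl⟩ := h; exact hu j
  | zero => simp
  | add V W _ _ hV hW => rw [add_mul, map_add]; exact add_mem hV hW
  | smul a W _ hW => rw [smul_mul_assoc, coeffwise_smul]; exact mul_mem a.2 hW

theorem coeffwise_mem (l : LaurentPolynomial K →ₗ[K] K)
    {W : PowerSeries (LaurentPolynomial K)} (hW : W ∈ laurentSpan K) :
    coeffwise l W ∈ algebraicSeries K := by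
  have h : ∀ j, coeffwise l (monom K j * 1) ∈ algebraicSeries K := fun j => by
    have : coeffwise l (monom K j * 1) =
        ((C (l (LaurentPolynomial.T j)) : algebraicSeries K) : PowerSeries K) := by
      ext n
      simp only [mul_one, coeff_coeffwise, monom, coe_C, PowerSeries.coeff_C]
      split_ifs <;> simp
    rw [this]
    exact Subtype.property _
  simpa using coeffwise_mul_mem h hW

end algebraicSeries

/-! ### Recursive functionals applied to rational functions. -/

/-- A linear functional on Laurent polynomials is *recursive at infinity* if for every `j` it
vanishes on `Cp * K[x] * x ^ j` for some monic polynomial `Cp`. -/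
def LaurentPolynomial.IsRecursiveAtInfinity {K : Type*} [Field K]
    (l : LaurentPolynomial K →ₗ[K] K) : Prop :=
  ∀ j : ℤ, ∃ q : Polynomial K, q.Monic ∧
    ∀ p : Polynomial K, l ((q * p).toLaurent * LaurentPolynomial.T j) = 0

namespace algebraicSeries

open LaurentPolynomial (coeffwise IsRecursiveAtInfinity)

variable {K : Type*} [Field K]

theorem coeffwise_monom_mul_mem {l : LaurentPolynomial K →ₗ[K] K}
    (hl : IsRecursiveAtInfinity l) {h : Polynomial (algebraicSeries K)}
    (hh : h.map constantCoeff = 1) {u : PowerSeries (LaurentPolynomial K)}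
    (hu : toLaurentSeries h * u = 1) (j : ℤ) :
    coeffwise l (monom K j * u) ∈ algebraicSeries K := by
  obtain ⟨q, hq, hlq⟩ := hl j
  obtain ⟨a, b, hab⟩ := isCoprime (hq.map C) hh
  -- The inverse of `h` has coefficients in `K[x]`, without negative powers; this is what lets `l`
  -- kill its multiples by `q x^j`.
  obtain ⟨v, hv⟩ : IsUnit (toSeries h) := by
    rw [PowerSeries.isUnit_iff_constantCoeff, constantCoeff_toSeries, hh]
    exact isUnit_one
  have huv : u = PowerSeries.map Polynomial.toLaurent (↑v⁻¹ : PowerSeries (Polynomial K)) := by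
    have h1 : toLaurentSeries h *
        PowerSeries.map Polynomial.toLaurent (↑v⁻¹ : PowerSeries (Polynomial K)) = 1 := by
      rw [toLaurentSeries, RingHom.comp_apply, ← map_mul, ← hv, Units.mul_inv, map_one]
    exact left_inv_eq_right_inv ((mul_comm _ _).trans hu) h1
  have hzero : coeffwise l (toLaurentSeries (a * q.map C) * monom K j * u) = 0 := by
    have hF : toLaurentSeries (a * q.map C) * monom K j * u =
        PowerSeries.map Polynomial.toLaurent
          (PowerSeries.C q * (toSeries a * (↑v⁻¹ : PowerSeries (Polynomial K)))) *
          monom K j := by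
      rw [huv, toLaurentSeries, RingHom.comp_apply, RingHom.map_mul toSeries, toSeries_map_C]
      simp only [map_mul]
      ring
    ext n
    rw [hF, coeff_coeffwise, monom, PowerSeries.coeff_mul_C, PowerSeries.coeff_map,
      PowerSeries.coeff_C_mul, hlq, map_zero]
  have hsplit : monom K j * u =
      toLaurentSeries (a * q.map C) * monom K j * u + toLaurentSeries b * monom K j := by
    have h1 := congrArg toLaurentSeries hab
    rw [map_add, map_mul toLaurentSeries b, map_one] at h1
    linear_combination (-(monom K j * u)) * h1 + toLaurentSeries b * monom K j * hu
  rw [hsplit, map_add, hzero, zero_add]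
  exact coeffwise_mem l (toLaurentSeries_mul_monom_mem b j)

/-- The substitution `x ↦ x⁻¹`, coefficientwise. -/
noncomputable def invert :
    PowerSeries (LaurentPolynomial K) →+* PowerSeries (LaurentPolynomial K) :=
  PowerSeries.map (LaurentPolynomial.invert (R := K) : _ →+* LaurentPolynomial K)

@[simp] theorem invert_monom (j : ℤ) : invert (monom K j) = monom K (-j) := by
  simp [invert, monom]

theorem coeffwise_invert (l : LaurentPolynomial K →ₗ[K] K)
    (F : PowerSeries (LaurentPolynomial K)) :
    coeffwise (l ∘ₗ (LaurentPolynomial.invert (R := K)).toLinearMap) (invert F) =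
      coeffwise l F := by
  ext n
  simp [invert, LaurentPolynomial.involutive_invert _]

theorem toLaurentSeries_reverse (g : Polynomial (algebraicSeries K)) :
    toLaurentSeries g.reverse = invert (toLaurentSeries g) * monom K g.natDegree := by
  let : Invertible (monom K (-1)) :=
    ⟨monom K 1, by rw [← monom_add]; simp, by rw [← monom_add]; simp⟩
  have h1 := Polynomial.eval₂_reverse_mul_pow
    (algebraMap (algebraicSeries K) (PowerSeries (LaurentPolynomial K))) (monom K (-1)) g
  have h2 : invert (toLaurentSeries g) =
      g.eval₂ (algebraMap (algebraicSeries K) _) (monom K (-1)) := by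
    rw [toLaurentSeries_eq_eval₂, Polynomial.hom_eval₂, invert_monom]
    congr 1
    ext a n
    simp [invert, algebraMap_eq_map]
  have h3 : monom K (-1) ^ g.natDegree * monom K g.natDegree = 1 := by
    rw [monom, monom, ← map_pow, LaurentPolynomial.T_pow, ← map_mul, ← LaurentPolynomial.T_add]
    simp
  rw [h2, ← h1, mul_assoc, h3, mul_one, toLaurentSeries_eq_eval₂]
  rfl

/-- Since `g` is monic with reduction `x^M`, its reverse has reduction `1`, and `x ↦ 1/x` turns
`1/g` into `x^M / g.reverse`. -/
theorem coeffwise_monom_mul_mem' {l : LaurentPolynomial K →ₗ[K] K}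
    (hl : IsRecursiveAtInfinity (l ∘ₗ (LaurentPolynomial.invert (R := K)).toLinearMap))
    {g : Polynomial (algebraicSeries K)} {M : ℕ} (hg : g.Monic)
    (hgM : g.map constantCoeff = Polynomial.X ^ M) {u : PowerSeries (LaurentPolynomial K)}
    (hu : toLaurentSeries g * u = 1) (j : ℤ) :
    coeffwise l (monom K j * u) ∈ algebraicSeries K := by
  have hdeg : g.natDegree = M := by
    rw [← hg.natDegree_map constantCoeff, hgM, Polynomial.natDegree_X_pow]
  have hrev : g.reverse.map constantCoeff = 1 := by
    rw [Polynomial.reverse, ← Polynomial.reflect_map, hgM, hdeg, Polynomial.reflect_monomial,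
      Polynomial.revAt_le le_rfl, Nat.sub_self, pow_zero]
  have hu' : toLaurentSeries g.reverse * (monom K (-g.natDegree) * invert u) = 1 := by
    have h1 : monom K (g.natDegree : ℤ) * monom K (-g.natDegree) = 1 := by
      rw [← monom_add, add_neg_cancel, monom_zero]
    have h2 : invert (toLaurentSeries g) * invert u = 1 := by rw [← map_mul, hu, map_one]
    rw [toLaurentSeries_reverse]
    linear_combination invert (toLaurentSeries g) * invert u * h1 + h2
  have h := coeffwise_monom_mul_mem hl hrev hu' (g.natDegree - j)
  rw [← coeffwise_invert, map_mul, invert_monom]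
  rwa [← mul_assoc, ← monom_add, show (g.natDegree - j : ℤ) + -g.natDegree = -j by ring] at h

/-- Coefficientwise application of a functional that is recursive at both ends to a rational
function gives an algebraic series. -/
theorem coeffwise_mem_of_mul_mem {l : LaurentPolynomial K →ₗ[K] K}
    (hl : IsRecursiveAtInfinity l)
    (hl' : IsRecursiveAtInfinity (l ∘ₗ (LaurentPolynomial.invert (R := K)).toLinearMap))
    {D G : PowerSeries (LaurentPolynomial K)} (hD : D ∈ laurentSpan K)
    (hD1 : PowerSeries.constantCoeff D = 1) (hDG : D * G ∈ laurentSpan K) :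
    coeffwise l G ∈ algebraicSeries K := by
  obtain ⟨M, f, hf⟩ := exists_toLaurentSeries_eq hD
  have hfM : f.map constantCoeff = Polynomial.X ^ M := by
    apply Polynomial.toLaurent_injective
    rw [← constantCoeff_toLaurentSeries, hf, map_mul, hD1, Polynomial.toLaurent_X_pow]
    simp [monom]
  obtain ⟨g, h, rfl, hg, hgM, hh⟩ := exists_factorization hfM
  obtain ⟨a, b, hab⟩ := isCoprime hg hh
  have hgu : IsUnit (toLaurentSeries g) := by
    rw [PowerSeries.isUnit_iff_constantCoeff, constantCoeff_toLaurentSeries, hgM,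
      Polynomial.toLaurent_X_pow]
    exact LaurentPolynomial.isUnit_T _
  have hhu : IsUnit (toLaurentSeries h) := by
    rw [PowerSeries.isUnit_iff_constantCoeff, constantCoeff_toLaurentSeries, hh, map_one]
    exact isUnit_one
  obtain ⟨ug, hug⟩ := hgu.exists_right_inv
  obtain ⟨uh, huh⟩ := hhu.exists_right_inv
  have hab' := congrArg toLaurentSeries hab
  simp only [map_add, map_mul, map_one] at hab' hf
  have hG : G = D * G * (monom K M * (ug * uh)) := by
    linear_combination (-G) * hug - G * toLaurentSeries g * ug * huh + G * ug * uh * hf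
  rw [hG]
  refine coeffwise_mul_mem (fun j => ?_) hDG
  -- Partial fractions: `a g + b h = 1` gives `1/(g h) = a/h + b/g`.
  have hsplit : monom K j * (monom K M * (ug * uh)) =
      (toLaurentSeries a * monom K (j + M)) * uh + (toLaurentSeries b * monom K (j + M)) * ug := by
    rw [monom_add]
    linear_combination (-(monom K j * monom K M * ug * uh)) * hab' +
      monom K j * monom K M * toLaurentSeries a * uh * hug +
      monom K j * monom K M * toLaurentSeries b * ug * huh
  rw [hsplit, map_add]
  exact add_mem
    (coeffwise_mul_mem (coeffwise_monom_mul_mem hl hh huh) (toLaurentSeries_mul_monom_mem a _))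
    (coeffwise_mul_mem (coeffwise_monom_mul_mem' hl' hg hgM hug)
      (toLaurentSeries_mul_monom_mem b _))

end algebraicSeries

/-! ### The functional attached to a two-sided sequence. -/

namespace LaurentPolynomial

variable {K : Type*} [Field K]

/-- The linear functional on Laurent polynomials with value `s k` at `x ^ k`. -/
noncomputable def pairing (s : ℤ → K) : LaurentPolynomial K →ₗ[K] K :=
  Finsupp.linearCombination K s ∘ₗ (AddMonoidAlgebra.coeffLinearEquiv K).toLinearMap

@[simp] theorem pairing_T (s : ℤ → K) (k : ℤ) : pairing s (T k) = s k := by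
  change Finsupp.linearCombination K s (Finsupp.single k 1) = s k
  simp

@[simp] theorem pairing_C_mul_T (s : ℤ → K) (c : K) (k : ℤ) :
    pairing s (C c * T k) = c * s k := by
  rw [← smul_eq_C_mul, map_smul, pairing_T, smul_eq_mul]

theorem pairing_comp_invert (s : ℤ → K) :
    pairing s ∘ₗ (invert (R := K)).toLinearMap = pairing fun k => s (-k) := by
  refine LinearMap.ext fun P => ?_
  induction P using LaurentPolynomial.induction_on' with
  | add p q hp hq => rw [map_add, map_add, hp, hq]
  | C_mul_T k c => simp

theorem laurentSubst_eq_pairing (P : LaurentPolynomial K) (a b : ℕ → K) :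
    laurentSubst P a b =
      pairing (fun k => if 0 ≤ k then a k.toNat else b (-k - 1).toNat) P := by
  change _ = Finsupp.linearCombination K _ P.coeff
  rw [Finsupp.linearCombination_apply, laurentSubst]
  refine Finsupp.sum_congr fun k _ => ?_
  split_ifs <;> rfl

theorem isRecursiveAtInfinity_pairing {s : ℤ → K} {u : ℕ → K}
    (hu : IsEventuallyLinearRecursive u) (m : ℤ) (hs : ∀ n : ℕ, s (m + n) = u n) :
    IsRecursiveAtInfinity (pairing s) := by
  obtain ⟨E, N, hE⟩ := hu
  intro j
  -- The power of `x` pushes all exponents to at least `m + N`, where the recurrence holds; there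
  -- `charPoly` pairs to zero.
  refine ⟨E.charPoly * Polynomial.X ^ (m + N - j).toNat,
    E.charPoly_monic.mul (Polynomial.monic_X_pow _), fun p => ?_⟩
  induction p using Polynomial.induction_on' with
  | add p q hp hq => rw [mul_add, map_add, add_mul, map_add, hp, hq, add_zero]
  | monomial i c =>
    obtain ⟨n, hn⟩ : ∃ n : ℕ, ((m + N - j).toNat : ℤ) + i + j = m + (n + N : ℕ) :=
      ⟨((m + N - j).toNat + i + j - m - N).toNat, by omega⟩
    have hmul : (E.charPoly * Polynomial.X ^ (m + N - j).toNat *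
        Polynomial.monomial i c).toLaurent * T j =
          C c * (E.charPoly.toLaurent * T (m + (n + N : ℕ))) := by
      rw [← hn, ← Polynomial.C_mul_X_pow_eq_monomial, T_add, T_add]
      simp only [map_mul, Polynomial.toLaurent_X_pow, Polynomial.toLaurent_C]
      ring
    have hval (k : ℕ) : pairing s (T k * T (m + (n + N : ℕ))) = u (n + k + N) := by
      rw [← T_add, pairing_T, ← hs]
      congr 1; push_cast; ring
    rw [hmul, ← smul_eq_C_mul, map_smul, LinearRecurrence.charPoly, map_sub, sub_mul, map_sub,
      map_sum, Finset.sum_mul, map_sum]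
    simp only [← Polynomial.C_mul_X_pow_eq_monomial, map_mul, Polynomial.toLaurent_X_pow,
      Polynomial.toLaurent_C, map_one, one_mul, ← smul_eq_C_mul, smul_mul_assoc,
      map_smul, hval, smul_eq_mul]
    rw [show u (n + E.order + N) = _ from hE n, sub_self, mul_zero]

end LaurentPolynomial

/-! ### Rationality of the generating series, and the conclusion. -/

/-- The generating series of an eventually linearly recursive sequence of Laurent polynomials is a
quotient `N / D` with `D ≡ 1` modulo `t`. -/
theorem IsEventuallyLinearRecursive.exists_mul_mk_mem {K : Type*} [Field K]
    {P : ℕ → LaurentPolynomial K} (hP : IsEventuallyLinearRecursive P) :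
    ∃ D ∈ algebraicSeries.laurentSpan K, PowerSeries.constantCoeff D = 1 ∧
      D * PowerSeries.mk P ∈ algebraicSeries.laurentSpan K := by
  obtain ⟨E, N, hE⟩ := hP
  let D : PowerSeries (LaurentPolynomial K) :=
    PowerSeries.C 1 - ∑ i : Fin E.order,
      PowerSeries.X ^ (E.order - i) * PowerSeries.C (E.coeffs i)
  refine ⟨D, sub_mem (algebraicSeries.C_mem 1) (sum_mem fun i _ =>
    algebraicSeries.X_pow_mul_mem (algebraicSeries.C_mem _) _), ?_, ?_⟩
  · have h (i : Fin E.order) : E.order - (i : ℕ) ≠ 0 := by omega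
    simp [D, h]
  -- From degree `E.order + N` on, the coefficients of `D G` express the recurrence, so `D G` is a
  -- polynomial in `t`.
  · have hcoeff (n : ℕ) (hn : E.order + N ≤ n) :
        PowerSeries.coeff n (D * PowerSeries.mk P) = 0 := by
      obtain ⟨k, rfl⟩ := Nat.exists_eq_add_of_le' hn
      have h : P (k + E.order + N) = ∑ i, E.coeffs i * P (k + i + N) := hE k
      simp only [D, sub_mul, map_one, one_mul, map_sub, PowerSeries.coeff_mk, Finset.sum_mul,
        map_sum, mul_assoc]
      rw [← add_assoc, h, sub_eq_zero]
      refine Finset.sum_congr rfl fun i _ => ?_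
      rw [show k + E.order + N = (k + i + N) + (E.order - i) by omega,
        PowerSeries.coeff_X_pow_mul, PowerSeries.coeff_C_mul, PowerSeries.coeff_mk]
    have htrunc : D * PowerSeries.mk P = ∑ n ∈ Finset.range (E.order + N),
        PowerSeries.X ^ n * PowerSeries.C (PowerSeries.coeff n (D * PowerSeries.mk P)) := by
      ext1 n
      simp only [map_sum, PowerSeries.coeff_mul_C, PowerSeries.coeff_X_pow, ite_mul, one_mul,
        zero_mul, Finset.sum_ite_eq, Finset.mem_range]
      split_ifs with hn
      · rfl
      · exact hcoeff n (not_lt.1 hn)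
    rw [htrunc]
    exact sum_mem fun n _ => algebraicSeries.X_pow_mul_mem (algebraicSeries.C_mem _) n

theorem mainTheorem8 {K : Type*} [Field K] (P : ℕ → LaurentPolynomial K) (a b : ℕ → K)
    (hP : IsEventuallyLinearRecursive P) (ha : IsEventuallyLinearRecursive a)
    (hb : IsEventuallyLinearRecursive b) :
    IsAlgebraicSequence (fun n => laurentSubst (P n) a b) := by
  obtain ⟨D, hD, hD1, hDG⟩ := hP.exists_mul_mk_mem
  let s : ℤ → K := fun k => if 0 ≤ k then a k.toNat else b (-k - 1).toNat
  have hl : LaurentPolynomial.IsRecursiveAtInfinity (LaurentPolynomial.pairing s) :=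
    LaurentPolynomial.isRecursiveAtInfinity_pairing ha 0 fun n => by simp [s]
  have hl' : LaurentPolynomial.IsRecursiveAtInfinity (LaurentPolynomial.pairing s ∘ₗ
      (LaurentPolynomial.invert (R := K)).toLinearMap) := by
    rw [LaurentPolynomial.pairing_comp_invert]
    -- The offset is `1` because `b 0` sits at `x⁻¹`.
    refine LaurentPolynomial.isRecursiveAtInfinity_pairing hb 1 fun n => ?_
    have h1 : ¬ (0 : ℤ) ≤ -(1 + n) := by omega
    have h2 : (- -(1 + (n : ℤ)) - 1).toNat = n := by omega
    simp only [s, if_neg h1, h2]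
  have hmem := algebraicSeries.coeffwise_mem_of_mul_mem hl hl' hD hD1 hDG
  have hH : hilbertSeries (fun n => laurentSubst (P n) a b) =
      LaurentPolynomial.coeffwise (LaurentPolynomial.pairing s) (PowerSeries.mk P) := by
    ext n
    simp only [hilbertSeries, PowerSeries.coeff_mk, algebraicSeries.coeff_coeffwise,
      LaurentPolynomial.laurentSubst_eq_pairing, s]
  rw [IsAlgebraicSequence, hH]
  exact hmem
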